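/- Let $H$ be a complex Hilbert space. A form $t$ in $H$ is a map $t[\cdot,\cdot]:\mathrm{dom}\,t\times \mathrm{dom}\,t\to\mathbb{C}$, linear in the first and antilinear in the second entry, where $\mathrm{dom}\,t$ is a (not necessarily closed or dense) linear subspace of $H$; write $t[\varphi]=t[\varphi,\varphi]$. The sum of two forms is defined on the intersection of their domains. The form $t$ is bounded if there is $a\ge 0$ with $|t[\varphi]|\le a\|\varphi\|^2$ for all $\varphi\in\mathrm{dom}\,t$; it is bounded from below by $c\in\mathbb{R}$ if $t[\varphi]$ is real and $t[\varphi]\ge c\|\varphi\|^2$ for all $\varphi\in\mathrm{dom}\,t$, semibounded if this holds for some $c\in\mathbb R$, and nonnegative if it holds for $c=0$. The form $t$ is closable if $\varphi_n\in\mathrm{dom}\,t$, $\varphi_n\to 0$ in $H$ and $t[\varphi_n-\varphi_m]\to 0$ $(n,m\to\infty)$ imply $t[\varphi_n]\to 0$. A nonnegative form $t$ is singular if for every $\varphi\in\mathrm{dom}\,t$ there is a sequence $\varphi_n\in\mathrm{dom}\,t$ with $\varphi_n\to\varphi$ in $H$ and $t[\varphi_n]\to 0$. A Lebesgue type decomposition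 of a semibounded form $t$ is a sum $t=t_1+t_2$ with $\mathrm{dom}\,t=\mathrm{dom}\,t_1=\mathrm{dom}\,t_2$, where $t_1$ is a semibounded closable form and $t_2$ is a nonnegative singular form. Let $t$ be a semibounded form in $H$, let $c\in\mathbb{R}$ be any lower bound of $t$, and let $Q$ be any representing map for $t-c$, that is, a linear operator from $H$ to a Hilbert space $K$ with $\mathrm{dom}\,Q=\mathrm{dom}\,t$ and $$t[\varphi,\psi]-c(\varphi,\psi)=(Q\varphi,Q\psi),\qquad \varphi,\psi\in\mathrm{dom}\,t$$ (such $Q$ exists for each lower bound $c$). Let $P_0$ be the orthogonal projection of $K$ onto the closed subspace $\mathrm{mul}\,Q^{**}$ of all $k\in K$ such that $(0,k)$ belongs to the closure $Q^{**}$ of the graph of $Q$ in $H\times K$. The Lebesgue decomposition of $t$ is $t=t_{\rm reg}+t_{\rm sing}$, where, for $\varphi,\psi\in\mathrm{dom}\,t$, $$t_{\rm reg}[\varphi,\psi]=c(\varphi,\psi)+((I-P_0)Q\varphi,(I-P_0)Q\psi),\qquad t_{\rm sing}[\varphi,\psi]=(P_0Q\varphi,P_0Q\psi).$$ Theorem.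 The following statements are equivalent: (i) the Lebesgue decomposition $t=t_{\rm reg}+t_{\rm sing}$ is the only Lebesgue type decomposition of $t$; (ii) the form $t_{\rm reg}$ is bounded. -/

import Mathlib

open Filter Topology
open scoped ComplexConjugate

universe u v

/-- A sesquilinear form in a complex Hilbert space `H`: a linear subspace `domain` of `H` (not
necessarily closed or dense) and a map `domain × domain → ℂ` that is linear in the first and
antilinear in the second entry. -/
structure SesqForm (H : Type u) [NormedAddCommGroup H] [InnerProductSpace ℂ H] where
  domain : Submodule ℂ H
  toFun : domain →ₗ[ℂ] domain →ₗ⋆[ℂ] ℂ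

namespace SesqForm

variable {H : Type u} [NormedAddCommGroup H] [InnerProductSpace ℂ H]
variable {K : Type v} [NormedAddCommGroup K] [InnerProductSpace ℂ K]

/-- `t φ ψ` is the value `t[φ, ψ]`. -/
instance : CoeFun (SesqForm H) (fun t => t.domain → t.domain → ℂ) := ⟨fun t φ ψ => t.toFun φ ψ⟩

theorem ext_of_values {s t : SesqForm H} (hd : s.domain = t.domain)
    (hv : ∀ (φ ψ : H) (hφ : φ ∈ s.domain) (hφ' : φ ∈ t.domain) (hψ : ψ ∈ s.domain)
      (hψ' : ψ ∈ t.domain), s ⟨φ, hφ⟩ ⟨ψ, hψ⟩ = t ⟨φ, hφ'⟩ ⟨ψ, hψ'⟩) : s = t := by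
  obtain ⟨D, f⟩ := s
  obtain ⟨D', g⟩ := t
  obtain rfl : D = D' := hd
  have : f = g := by
    ext φ ψ
    exact hv φ ψ φ.2 φ.2 ψ.2 ψ.2
  rw [this]

/-- The sum of two forms, on the intersection of the domains. -/
instance : Add (SesqForm H) where
  add s t :=
    { domain := s.domain ⊓ t.domain
      toFun := LinearMap.mk₂'ₛₗ (RingHom.id ℂ) (starRingEnd ℂ)
        (fun φ ψ => s ⟨φ, φ.2.1⟩ ⟨ψ, ψ.2.1⟩ + t ⟨φ, φ.2.2⟩ ⟨ψ, ψ.2.2⟩)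
        (fun a b ψ => by
          have h₁ := congrArg (fun f => f ⟨(ψ : H), ψ.2.1⟩)
            (s.toFun.map_add ⟨(a : H), a.2.1⟩ ⟨(b : H), b.2.1⟩)
          have h₂ := congrArg (fun f => f ⟨(ψ : H), ψ.2.2⟩)
            (t.toFun.map_add ⟨(a : H), a.2.2⟩ ⟨(b : H), b.2.2⟩)
          simp only [LinearMap.add_apply] at h₁ h₂
          exact (congrArg₂ (· + ·) h₁ h₂).trans (by ring))
        (fun c a ψ => by
          have h₁ := congrArg (fun f => f ⟨(ψ : H), ψ.2.1⟩)
            (s.toFun.map_smul c ⟨(a : H), a.2.1⟩)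
          have h₂ := congrArg (fun f => f ⟨(ψ : H), ψ.2.2⟩)
            (t.toFun.map_smul c ⟨(a : H), a.2.2⟩)
          simp only [LinearMap.smul_apply] at h₁ h₂
          exact (congrArg₂ (· + ·) h₁ h₂).trans (smul_add _ _ _).symm)
        (fun φ a b => by
          have h₁ := (s.toFun ⟨(φ : H), φ.2.1⟩).map_add ⟨(a : H), a.2.1⟩ ⟨(b : H), b.2.1⟩
          have h₂ := (t.toFun ⟨(φ : H), φ.2.2⟩).map_add ⟨(a : H), a.2.2⟩ ⟨(b : H), b.2.2⟩
          exact (congrArg₂ (· + ·) h₁ h₂).trans (by ring))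
        (fun c φ a => by
          have h₁ := (s.toFun ⟨(φ : H), φ.2.1⟩).map_smulₛₗ c ⟨(a : H), a.2.1⟩
          have h₂ := (t.toFun ⟨(φ : H), φ.2.2⟩).map_smulₛₗ c ⟨(a : H), a.2.2⟩
          exact (congrArg₂ (· + ·) h₁ h₂).trans (smul_add _ _ _).symm) }

theorem add_domain (s t : SesqForm H) : (s + t).domain = s.domain ⊓ t.domain := rfl

theorem add_apply (s t : SesqForm H) (φ ψ : (s + t).domain) :
    (s + t) φ ψ = s ⟨φ, φ.2.1⟩ ⟨ψ, ψ.2.1⟩ + t ⟨φ, φ.2.2⟩ ⟨ψ, ψ.2.2⟩ := rfl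

/-- The form `[φ, ψ] ↦ (Q φ, Q ψ)` on `dom Q`, for a linear operator `Q` from `H` to `K`. The inner
product of Mathlib is antilinear in its first entry, so that `(f, g)` is `inner ℂ g f`. -/
noncomputable def ofOperator (Q : H →ₗ.[ℂ] K) : SesqForm H where
  domain := Q.domain
  toFun := LinearMap.mk₂'ₛₗ (RingHom.id ℂ) (starRingEnd ℂ)
    (fun φ ψ => inner ℂ (Q ψ) (Q φ))
    (fun a b ψ => by rw [Q.map_add, inner_add_right])
    (fun c a ψ => by rw [Q.map_smul, inner_smul_right]; rfl)
    (fun φ a b => by rw [Q.map_add, inner_add_left])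
    (fun c φ a => by rw [Q.map_smul, inner_smul_left]; rfl)

theorem ofOperator_apply (Q : H →ₗ.[ℂ] K) (φ ψ : Q.domain) :
    ofOperator Q φ ψ = inner ℂ (Q ψ) (Q φ) := rfl

/-- The form `t + c`, i.e. `[φ, ψ] ↦ t[φ, ψ] + c (φ, ψ)` on `dom t`, for a real number `c`. -/
noncomputable def addConst (t : SesqForm H) (c : ℝ) : SesqForm H where
  domain := t.domain
  toFun := LinearMap.mk₂'ₛₗ (RingHom.id ℂ) (starRingEnd ℂ)
    (fun φ ψ => t φ ψ + (c : ℂ) * inner ℂ (ψ : H) (φ : H))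
    (fun a b ψ => by
      simp only [map_add, LinearMap.add_apply, Submodule.coe_add, inner_add_right]; ring)
    (fun k a ψ => by
      simp only [map_smul, LinearMap.smul_apply, Submodule.coe_smul, inner_smul_right,
        smul_eq_mul, RingHom.id_apply]; ring)
    (fun φ a b => by
      simp only [map_add, Submodule.coe_add, inner_add_left]; ring)
    (fun k φ a => by
      simp only [LinearMap.map_smulₛₗ, Submodule.coe_smul, inner_smul_left, smul_eq_mul]; ring)

theorem addConst_apply (t : SesqForm H) (c : ℝ) (φ ψ : t.domain) :
    t.addConst c φ ψ = t φ ψ + (c : ℂ) * inner ℂ (ψ : H) (φ : H) := rfl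

/-- `t` is bounded. -/
def IsBounded (t : SesqForm H) : Prop :=
  ∃ a : ℝ, 0 ≤ a ∧ ∀ φ : t.domain, ‖t φ φ‖ ≤ a * ‖(φ : H)‖ ^ 2

/-- `t` is bounded from below by the real number `c`: every `t[φ]` is real and
`t[φ] ≥ c ‖φ‖²`. -/
def IsBoundedBelow (t : SesqForm H) (c : ℝ) : Prop :=
  ∀ φ : t.domain, (t φ φ).im = 0 ∧ c * ‖(φ : H)‖ ^ 2 ≤ (t φ φ).re

/-- `t` is semibounded (from below). -/
def IsSemibounded (t : SesqForm H) : Prop := ∃ c : ℝ, t.IsBoundedBelow c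

/-- `t` is nonnegative: every `t[φ]` is real and `t[φ] ≥ 0`. -/
def IsNonneg (t : SesqForm H) : Prop :=
  ∀ φ : t.domain, (t φ φ).im = 0 ∧ 0 ≤ (t φ φ).re

/-- `t` is closable: if `φ n ∈ dom t`, `φ n → 0` in `H` and `t[φ n - φ m] → 0` as `n, m → ∞`,
then `t[φ n] → 0`. -/
def IsClosable (t : SesqForm H) : Prop :=
  ∀ φ : ℕ → t.domain, Tendsto (fun n => (φ n : H)) atTop (𝓝 0) →
    Tendsto (fun p : ℕ × ℕ => t (φ p.1 - φ p.2) (φ p.1 - φ p.2)) atTop (𝓝 0) →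
    Tendsto (fun n => t (φ n) (φ n)) atTop (𝓝 0)

/-- Singularity of a (nonnegative) form `t`: for every `φ ∈ dom t` there are `φ' n ∈ dom t` with
`φ' n → φ` in `H` and `t[φ' n] → 0`. -/
def IsSingular (t : SesqForm H) : Prop :=
  ∀ φ : t.domain, ∃ φ' : ℕ → t.domain,
    Tendsto (fun n => (φ' n : H)) atTop (𝓝 (φ : H)) ∧
    Tendsto (fun n => t (φ' n) (φ' n)) atTop (𝓝 0)

/-- `t = t₁ + t₂` is a Lebesgue type decomposition of `t`. -/
structure IsLebesgueTypeDecomposition (t t₁ t₂ : SesqForm H) : Prop where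
  sum_eq : t = t₁ + t₂
  domain_left : t₁.domain = t.domain
  domain_right : t₂.domain = t.domain
  semibounded_left : t₁.IsSemibounded
  closable_left : t₁.IsClosable
  nonneg_right : t₂.IsNonneg
  singular_right : t₂.IsSingular

/-- `Q` is a representing map for `t - c`: `dom Q = dom t` and `(t - c)[φ, ψ] = (Q φ, Q ψ)`. -/
def IsRepresentingMap (t : SesqForm H) (c : ℝ) (Q : H →ₗ.[ℂ] K) : Prop :=
  t.addConst (-c) = ofOperator Q

/-- `mul Q**`: the closed subspace of all `k` such that `{0, k}` lies in the closure `Q**` of the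
graph of `Q`. -/
noncomputable def mulClosure (Q : H →ₗ.[ℂ] K) : Submodule ℂ K :=
  Q.graph.topologicalClosure.comap (LinearMap.inr ℂ H K)

theorem isClosed_mulClosure (Q : H →ₗ.[ℂ] K) : IsClosed (mulClosure Q : Set K) :=
  Q.graph.isClosed_topologicalClosure.preimage (by
    change Continuous fun k : K => ((0 : H), k)
    fun_prop)

instance [CompleteSpace K] (Q : H →ₗ.[ℂ] K) : CompleteSpace (mulClosure Q) :=
  (isClosed_mulClosure Q).completeSpace_coe

/-- `Q_sing = P₀ Q`, where `P₀` is the orthogonal projection of `K` onto `mul Q**`. -/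
noncomputable def singOperator [CompleteSpace K] (Q : H →ₗ.[ℂ] K) : H →ₗ.[ℂ] K :=
  (mulClosure Q).starProjection.toLinearMap.compPMap Q

/-- `Q_reg = (I - P₀) Q`, where `P₀` is the orthogonal projection of `K` onto `mul Q**`. -/
noncomputable def regOperator [CompleteSpace K] (Q : H →ₗ.[ℂ] K) : H →ₗ.[ℂ] K :=
  (ContinuousLinearMap.id ℂ K - (mulClosure Q).starProjection).toLinearMap.compPMap Q

/-- The regular part `t_reg[φ, ψ] = c (φ, ψ) + (Q_reg φ, Q_reg ψ)` of the form `t` for which `Q` is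
a representing map of `t - c`. -/
noncomputable def regPart [CompleteSpace K] (c : ℝ) (Q : H →ₗ.[ℂ] K) : SesqForm H :=
  (ofOperator (regOperator Q)).addConst c

/-- The singular part `t_sing[φ, ψ] = (Q_sing φ, Q_sing ψ)` of the form `t` for which `Q` is a
representing map of `t - c`. -/
noncomputable def singPart [CompleteSpace K] (Q : H →ₗ.[ℂ] K) : SesqForm H :=
  ofOperator (singOperator Q)

theorem conj_symm_of_real (s : SesqForm H) (hs : ∀ φ, (s φ φ).im = 0) (φ ψ : s.domain) :
    conj (s φ ψ) = s ψ φ := by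
  have h₁ := hs (φ + ψ)
  have h₂ := hs (φ + Complex.I • ψ)
  have hφ := hs φ
  have hψ := hs ψ
  simp only [map_add, LinearMap.add_apply, LinearMap.smul_apply,
    LinearMap.map_smulₛₗ, smul_eq_mul, Complex.add_im, Complex.mul_im, Complex.mul_re,
    Complex.add_re, RingHom.id_apply,
    Complex.I_re, Complex.I_im, Complex.conj_I, Complex.neg_re, Complex.neg_im] at h₁ h₂
  apply Complex.ext
  · simp only [Complex.conj_re]; linarith
  · simp only [Complex.conj_im]; linarith

attribute [local instance] InnerProductSpace.Core.toSeminormedAddCommGroup in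
/-- A complex vector space with a semi-inner product maps isometrically into a Hilbert space. -/
theorem exists_linearMap_inner {V : Type u} [AddCommGroup V] [Module ℂ V]
    (cd : PreInnerProductSpace.Core ℂ V) :
    ∃ (K : Type u) (_ : NormedAddCommGroup K) (_ : InnerProductSpace ℂ K) (_ : CompleteSpace K)
      (j : V →ₗ[ℂ] K), ∀ φ ψ : V, inner ℂ (j φ) (j ψ) = cd.inner φ ψ := by
  let _ : InnerProductSpace ℂ V := InnerProductSpace.ofCore cd
  exact ⟨UniformSpace.Completion V, inferInstance, inferInstance, inferInstance,
    (UniformSpace.Completion.toComplL (𝕜 := ℂ) (E := V)).toLinearMap,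
    fun φ ψ => UniformSpace.Completion.inner_coe (𝕜 := ℂ) φ ψ⟩

/-- For every lower bound `c` of `t` there is a representing map for `t - c`. -/
theorem exists_isRepresentingMap (t : SesqForm H) (c : ℝ) (hc : t.IsBoundedBelow c) :
    ∃ (K : Type u) (_ : NormedAddCommGroup K) (_ : InnerProductSpace ℂ K) (_ : CompleteSpace K)
      (Q : H →ₗ.[ℂ] K), t.IsRepresentingMap c Q := by
  let s := t.addConst (-c)
  have hval (φ : s.domain) : s φ φ = t φ φ + ((-c : ℝ) : ℂ) * ((‖(φ : H)‖ ^ 2 : ℝ) : ℂ) := by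
    change t φ φ + _ * inner ℂ (φ : H) (φ : H) = _
    rw [inner_self_eq_norm_sq_to_K]
    push_cast
    rfl
  have hreal (φ : s.domain) : (s φ φ).im = 0 := by
    rw [hval, Complex.add_im, Complex.im_ofReal_mul, Complex.ofReal_im, (hc φ).1]
    ring
  have hpos (φ : s.domain) : 0 ≤ (s φ φ).re := by
    rw [hval, Complex.add_re, Complex.re_ofReal_mul, Complex.ofReal_re]
    linarith [(hc φ).2]
  obtain ⟨K, i₁, i₂, i₃, j, hj⟩ := exists_linearMap_inner (V := s.domain)
    { inner := fun φ ψ => s ψ φ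
      conj_inner_symm := fun φ ψ => s.conj_symm_of_real hreal _ _
      re_inner_nonneg := fun φ => hpos _
      add_left := fun a b ψ => (s.toFun ψ).map_add _ _
      smul_left := fun a ψ k => (s.toFun ψ).map_smulₛₗ _ _ }
  refine ⟨K, i₁, i₂, i₃, ⟨s.domain, j⟩, ext_of_values rfl fun φ ψ hφ hφ' hψ hψ' => ?_⟩
  exact (hj ⟨ψ, hψ⟩ ⟨φ, hφ⟩).symm

end SesqForm

/-!
A form `t` represented by `Q` as `t = (Q ·, Q ·) + c (·, ·)` is split by splitting `Q` along a
closed subspace `N` of `K`, with orthogonal projection `P`: the form of `(I - P) Q` (plus the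
constant) is closable if `mul ((I - P) Q)** ⊆ N`, and the form of `P Q` is singular if
`N ⊆ mul (P Q)**`
(`isLebesgueTypeDecomposition_of_projection`). For `N = mul Q**` this is the Lebesgue decomposition.

*If `t_reg` is unbounded*, the uniform boundedness principle yields `e ⊥ mul Q**` for which the
functional `(Q ·, e)` is unbounded (`exists_seq_of_not_isBounded`). The subspace
`N = mul Q** + span {e}` then also satisfies both conditions: closability survives because a closed
graph plus a line is closed, and singularity because `(Q ·, e)` is unbounded. The singular part of
this decomposition differs from `t_sing` (`exists_isLebesgueTypeDecomposition_ne`).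

*If `t_reg` is bounded*, let `t = t₁ + t₂` be any Lebesgue type decomposition. In general `t_reg` is
the largest closable part, so `t₁ ≤ t_reg` (`norm_sq_le_of_isClosable`): for `φ` choose a null
sequence `h n` with `Q (h n) → P₀ Q φ`; then `t[φ - h n] → t_reg[φ]`, whereas
`t₁[φ - h n] → t₁[φ]` since `t₁` is closable. Hence `t_reg - t₁ = t₂ - t_sing` is nonnegative,
bounded and below the singular form `t₂`; by continuity it vanishes (`eq_regPart_of_isBounded`).
-/

namespace SesqForm

variable {H : Type u} [NormedAddCommGroup H] [InnerProductSpace ℂ H]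
variable {K : Type v} [NormedAddCommGroup K] [InnerProductSpace ℂ K]

/-! ### Values of forms -/

theorem addConst_ofOperator_self (Q : H →ₗ.[ℂ] K) (c : ℝ) (φ : Q.domain) :
    (ofOperator Q).addConst c φ φ = ((‖Q φ‖ ^ 2 + c * ‖(φ : H)‖ ^ 2 : ℝ) : ℂ) := by
  rw [addConst_apply (ofOperator Q) c φ φ, ofOperator_apply, inner_self_eq_norm_sq_to_K,
    inner_self_eq_norm_sq_to_K]
  push_cast
  rfl

theorem ofOperator_self (Q : H →ₗ.[ℂ] K) (φ : Q.domain) :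
    ofOperator Q φ φ = ((‖Q φ‖ ^ 2 : ℝ) : ℂ) := by
  rw [ofOperator_apply, inner_self_eq_norm_sq_to_K]
  push_cast
  rfl

theorem IsRepresentingMap.eq_addConst {t : SesqForm H} {c : ℝ} {Q : H →ₗ.[ℂ] K}
    (hQ : t.IsRepresentingMap c Q) : t = (ofOperator Q).addConst c := by
  rw [← hQ]
  refine ext_of_values rfl fun φ ψ hφ _ hψ _ => ?_
  change t ⟨φ, hφ⟩ ⟨ψ, hψ⟩
    = t ⟨φ, hφ⟩ ⟨ψ, hψ⟩ + ((-c : ℝ) : ℂ) * inner ℂ ψ φ + (c : ℂ) * inner ℂ ψ φ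
  push_cast
  ring

theorem apply_eq_of_eq {s t : SesqForm H} (h : s = t) (φ ψ : H) (hφ : φ ∈ s.domain)
    (hφ' : φ ∈ t.domain) (hψ : ψ ∈ s.domain) (hψ' : ψ ∈ t.domain) :
    s ⟨φ, hφ⟩ ⟨ψ, hψ⟩ = t ⟨φ, hφ'⟩ ⟨ψ, hψ'⟩ := by
  subst h
  rfl

/-- Polarization: a form is determined by its quadratic form. -/
theorem eq_of_apply_self_eq {s t : SesqForm H} (hd : s.domain = t.domain)
    (hv : ∀ (φ : H) (hφ : φ ∈ s.domain) (hφ' : φ ∈ t.domain),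
      s ⟨φ, hφ⟩ ⟨φ, hφ⟩ = t ⟨φ, hφ'⟩ ⟨φ, hφ'⟩) : s = t := by
  obtain ⟨D, f⟩ := s
  obtain ⟨D', g⟩ := t
  obtain rfl : D = D' := hd
  replace hv (φ : D) : f φ φ = g φ φ := hv φ φ.2 φ.2
  refine ext_of_values rfl fun φ ψ hφ _ hψ _ => ?_
  change f ⟨φ, hφ⟩ ⟨ψ, hψ⟩ = g ⟨φ, hφ⟩ ⟨ψ, hψ⟩
  generalize (⟨φ, hφ⟩ : D) = x, (⟨ψ, hψ⟩ : D) = y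
  have h₁ := hv (x + y)
  have h₂ := hv (x + Complex.I • y)
  have hx := hv x
  have hy := hv y
  simp only [map_add, LinearMap.add_apply, LinearMap.smul_apply, LinearMap.map_smulₛₗ,
    smul_eq_mul, RingHom.id_apply, Complex.conj_I] at h₁ h₂
  linear_combination (1 / 2 : ℂ) * h₁ + (Complex.I / 2) * h₂
    - (1 / 2 + Complex.I / 2) * (hx + hy)
    + (1 / 2 * (f x y - g x y) + (- 1 / 2) * (f y x - g y x)
      + Complex.I / 2 * (f y y - g y y)) * Complex.I_sq

theorem eq_right_of_add_eq_add {s u v : SesqForm H} (hu : u.domain = s.domain)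
    (hv : v.domain = s.domain) (h : s + u = s + v) : u = v := by
  refine ext_of_values (hu.trans hv.symm) fun φ ψ hφ hφ' hψ hψ' => ?_
  exact add_left_cancel (apply_eq_of_eq h φ ψ ⟨hu ▸ hφ, hφ⟩ ⟨hu ▸ hφ, hφ'⟩ ⟨hu ▸ hψ, hψ⟩
    ⟨hu ▸ hψ, hψ'⟩)

/-! ### Closures of graphs and closability -/

theorem mem_topologicalClosure_graph_iff (Q : H →ₗ.[ℂ] K) (x : H) (k : K) :
    (x, k) ∈ Q.graph.topologicalClosure ↔ ∃ φ : ℕ → Q.domain,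
      Tendsto (fun n => (φ n : H)) atTop (𝓝 x) ∧ Tendsto (fun n => Q (φ n)) atTop (𝓝 k) := by
  rw [← SetLike.mem_coe, Submodule.topologicalClosure_coe, mem_closure_iff_seq_limit]
  constructor
  · rintro ⟨p, hp, hlim⟩
    choose φ hφ using fun n => (Q.mem_graph_iff' (x := p n)).1 (hp n)
    obtain rfl : p = fun n => ((φ n : H), Q (φ n)) := funext fun n => (hφ n).symm
    rw [Prod.tendsto_iff] at hlim
    exact ⟨φ, hlim⟩
  · rintro ⟨φ, h₁, h₂⟩
    exact ⟨fun n => ((φ n : H), Q (φ n)), fun n => Q.mem_graph (φ n), h₁.prodMk_nhds h₂⟩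

theorem mem_mulClosure_iff (Q : H →ₗ.[ℂ] K) (k : K) :
    k ∈ mulClosure Q ↔ ∃ φ : ℕ → Q.domain,
      Tendsto (fun n => (φ n : H)) atTop (𝓝 0) ∧ Tendsto (fun n => Q (φ n)) atTop (𝓝 k) :=
  mem_topologicalClosure_graph_iff Q 0 k

/-- The form `(Q φ, Q ψ) + c (φ, ψ)` is closable as soon as `Q` is a closable operator. -/
theorem isClosable_addConst_ofOperator [CompleteSpace K] (Q : H →ₗ.[ℂ] K) (c : ℝ)
    (hQ : mulClosure Q = ⊥) : ((ofOperator Q).addConst c).IsClosable := by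
  intro φ hφ hd
  change ℕ → Q.domain at φ
  have hsub : Tendsto (fun p : ℕ × ℕ => ((φ p.1 : H) - φ p.2)) atTop (𝓝 0) := by
    have h := (hφ.comp tendsto_fst).sub (hφ.comp tendsto_snd)
    rw [prod_atTop_atTop_eq, sub_zero] at h
    exact h
  have hQd : Tendsto (fun p : ℕ × ℕ => ‖Q (φ p.1) - Q (φ p.2)‖ ^ 2) atTop (𝓝 0) := by
    have h₁ := (Complex.continuous_re.tendsto 0).comp hd
    have h₂ := h₁.sub ((hsub.norm.pow 2).const_mul c)
    simp only [norm_zero, Complex.zero_re, ne_eq, OfNat.ofNat_ne_zero, not_false_eq_true,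
      zero_pow, mul_zero, sub_zero] at h₂
    refine h₂.congr fun p => ?_
    change ((ofOperator Q).addConst c (φ p.1 - φ p.2) (φ p.1 - φ p.2)).re - _ = _
    rw [addConst_ofOperator_self Q c (φ p.1 - φ p.2), Complex.ofReal_re, Q.map_sub]
    simp
  have hQn : Tendsto (fun p : ℕ × ℕ => ‖Q (φ p.1) - Q (φ p.2)‖) atTop (𝓝 0) := by
    simpa [Real.sqrt_sq (norm_nonneg _)] using hQd.sqrt
  have hc : CauchySeq fun n => Q (φ n) := by
    rw [cauchySeq_iff_tendsto_dist_atTop_0]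
    simpa only [dist_eq_norm] using hQn
  obtain ⟨k, hk⟩ := cauchySeq_tendsto_of_complete hc
  have hk0 : k ∈ mulClosure Q := (mem_mulClosure_iff Q k).2 ⟨φ, hφ, hk⟩
  rw [hQ, Submodule.mem_bot] at hk0
  subst hk0
  have h := (hk.norm.pow 2).add ((hφ.norm.pow 2).const_mul c)
  have h' := (Complex.continuous_ofReal.tendsto _).comp h
  simp only [norm_zero, ne_eq, OfNat.ofNat_ne_zero, not_false_eq_true,
      zero_pow, mul_zero, add_zero, Complex.ofReal_zero] at h'
  exact h'.congr fun n => (addConst_ofOperator_self Q c (φ n)).symm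

/-! ### Decompositions given by orthogonal projections -/

/-- The operator `P Q`, where `P` is the orthogonal projection of `K` onto `N`. -/
noncomputable def projOperator (N : Submodule ℂ K) [N.HasOrthogonalProjection]
    (Q : H →ₗ.[ℂ] K) : H →ₗ.[ℂ] K :=
  N.starProjection.toLinearMap.compPMap Q

/-- The operator `(I - P) Q`, where `P` is the orthogonal projection of `K` onto `N`. -/
noncomputable def coprojOperator (N : Submodule ℂ K) [N.HasOrthogonalProjection]
    (Q : H →ₗ.[ℂ] K) : H →ₗ.[ℂ] K :=
  (ContinuousLinearMap.id ℂ K - N.starProjection).toLinearMap.compPMap Q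

section Projection

variable (N : Submodule ℂ K) [N.HasOrthogonalProjection] (Q : H →ₗ.[ℂ] K)

theorem projOperator_apply (φ : Q.domain) : projOperator N Q φ = N.starProjection (Q φ) := rfl

theorem coprojOperator_apply (φ : Q.domain) :
    coprojOperator N Q φ = Q φ - N.starProjection (Q φ) := rfl

theorem norm_sq_eq_coproj_add_proj (v : K) :
    ‖v‖ ^ 2 = ‖v - N.starProjection v‖ ^ 2 + ‖N.starProjection v‖ ^ 2 := by
  have h := norm_add_sq_eq_norm_sq_add_norm_sq_of_inner_eq_zero (𝕜 := ℂ)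
    (v - N.starProjection v) (N.starProjection v)
    (N.starProjection_inner_eq_zero v _ (N.starProjection_apply_mem v))
  rw [sub_add_cancel] at h
  simpa only [pow_two] using h

theorem mulClosure_coprojOperator_le_orthogonal : mulClosure (coprojOperator N Q) ≤ Nᗮ := by
  intro k hk
  obtain ⟨φ, -, h⟩ := (mem_mulClosure_iff _ k).1 hk
  exact N.isClosed_orthogonal.mem_of_tendsto h
    (.of_forall fun n => N.sub_starProjection_mem_orthogonal (Q (φ n)))

/-- The splitting `Q = (I - P) Q + P Q` gives a Lebesgue type decomposition when `(I - P) Q` has no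
multivalued part and the multivalued part of the closure of `P Q` is all of `N`. -/
theorem isLebesgueTypeDecomposition_of_projection [CompleteSpace K] (c : ℝ)
    (hco : mulClosure (coprojOperator N Q) ≤ N) (hpr : N ≤ mulClosure (projOperator N Q)) :
    ((ofOperator Q).addConst c).IsLebesgueTypeDecomposition
      ((ofOperator (coprojOperator N Q)).addConst c) (ofOperator (projOperator N Q)) where
  sum_eq := by
    refine eq_of_apply_self_eq (inf_idem _).symm fun φ hφ _ => ?_
    rw [add_apply]
    refine (addConst_ofOperator_self Q c ⟨φ, hφ⟩).trans ?_
    refine Eq.trans ?_ (congrArg₂ (· + ·)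
      (addConst_ofOperator_self (coprojOperator N Q) c ⟨φ, hφ⟩)
      (ofOperator_self (projOperator N Q) ⟨φ, hφ⟩)).symm
    rw [norm_sq_eq_coproj_add_proj N (Q ⟨φ, hφ⟩)]
    change _ = ((‖Q ⟨φ, hφ⟩ - N.starProjection (Q ⟨φ, hφ⟩)‖ ^ 2 + c * ‖φ‖ ^ 2 : ℝ) : ℂ)
      + ((‖N.starProjection (Q ⟨φ, hφ⟩)‖ ^ 2 : ℝ) : ℂ)
    push_cast
    ring
  domain_left := rfl
  domain_right := rfl
  semibounded_left := by
    refine ⟨c, fun φ => ?_⟩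
    rw [addConst_ofOperator_self (coprojOperator N Q) c φ]
    refine ⟨Complex.ofReal_im _, ?_⟩
    rw [Complex.ofReal_re]
    exact le_add_of_nonneg_left (sq_nonneg _)
  closable_left := by
    refine isClosable_addConst_ofOperator _ c (le_bot_iff.1 ?_)
    rw [← N.inf_orthogonal_eq_bot]
    exact le_inf hco (mulClosure_coprojOperator_le_orthogonal N Q)
  nonneg_right := fun φ => by
    rw [ofOperator_self (projOperator N Q) φ]
    exact ⟨Complex.ofReal_im _, by rw [Complex.ofReal_re]; positivity⟩
  singular_right := fun φ => by
    change Q.domain at φ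
    obtain ⟨h, h₀, h₁⟩ := (mem_mulClosure_iff _ _).1
      (hpr (N.starProjection_apply_mem (Q φ)))
    change ℕ → Q.domain at h
    refine ⟨fun n => φ - h n, by simpa using h₀.const_sub (φ : H), ?_⟩
    have h₂ := (h₁.const_sub (N.starProjection (Q φ))).norm.pow 2
    rw [sub_self, norm_zero, zero_pow two_ne_zero] at h₂
    have h₃ := (Complex.continuous_ofReal.tendsto _).comp h₂
    rw [Complex.ofReal_zero] at h₃
    refine h₃.congr fun n => ?_
    rw [ofOperator_self (projOperator N Q) (φ - h n), projOperator_apply N Q (φ - h n),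
      Q.map_sub, map_sub]
    rfl

theorem mulClosure_le_mulClosure_projOperator (hN : mulClosure Q ≤ N) :
    mulClosure Q ≤ mulClosure (projOperator N Q) := by
  intro m hm
  obtain ⟨φ, h₀, h₁⟩ := (mem_mulClosure_iff _ _).1 hm
  refine (mem_mulClosure_iff _ _).2 ⟨φ, h₀, ?_⟩
  have h := (N.starProjection.continuous.tendsto m).comp h₁
  rw [Submodule.starProjection_eq_self_iff.2 (hN hm)] at h
  exact h

/-- Enlarging `mul Q**` by one direction `e` leaves the complementary part of `Q` closable: a
closed subspace plus a line is closed, so the closure of the graph of `(I - P) Q` lies in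
`Q** + span {(0, e)}`. -/
theorem mulClosure_coprojOperator_le (e : K)
    (hN : N = mulClosure Q ⊔ Submodule.span ℂ {e}) : mulClosure (coprojOperator N Q) ≤ N := by
  let S := Q.graph.topologicalClosure ⊔ Submodule.span ℂ {((0 : H), e)}
  have hS : IsClosed (S : Set (H × K)) :=
    Submodule.isClosed_sup_finiteDimensional _ _ Q.graph.isClosed_topologicalClosure
  have hle : (coprojOperator N Q).graph.topologicalClosure ≤ S := by
    refine Submodule.topologicalClosure_minimal _ (fun p hp => ?_) hS
    obtain ⟨φ, rfl⟩ := (LinearPMap.mem_graph_iff' _).1 hp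
    change Q.domain at φ
    obtain ⟨m, hm, w, hw, hmw⟩ :=
      Submodule.mem_sup.1 (hN.le (N.starProjection_apply_mem (Q φ)))
    obtain ⟨a, rfl⟩ := Submodule.mem_span_singleton.1 hw
    refine Submodule.mem_sup.2 ⟨((φ : H), Q φ) - (0, m),
      sub_mem (Q.graph.le_topologicalClosure (Q.mem_graph φ)) hm, -(a • ((0 : H), e)),
      neg_mem (Submodule.smul_mem _ a (Submodule.mem_span_singleton_self _)), ?_⟩
    rw [coprojOperator_apply, ← hmw]
    simp [sub_eq_add_neg, add_assoc, add_comm, add_left_comm]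
  intro k hk
  obtain ⟨p, hp, w, hw, hpw⟩ := Submodule.mem_sup.1 (hle hk)
  obtain ⟨a, rfl⟩ := Submodule.mem_span_singleton.1 hw
  have hk' : (0, k - a • e) = p := by
    rw [← sub_eq_iff_eq_add.2 hpw.symm]
    simp
  rw [hN]
  exact Submodule.mem_sup.2 ⟨k - a • e, by rw [← hk'] at hp; exact hp, a • e,
    Submodule.smul_mem _ a (Submodule.mem_span_singleton_self e), sub_add_cancel _ _⟩

end Projection

theorem isLebesgueTypeDecomposition_regPart_singPart [CompleteSpace K] (c : ℝ)
    (Q : H →ₗ.[ℂ] K) :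
    ((ofOperator Q).addConst c).IsLebesgueTypeDecomposition (regPart c Q) (singPart Q) :=
  isLebesgueTypeDecomposition_of_projection (mulClosure Q) Q c
    (mulClosure_coprojOperator_le _ Q 0 (by simp))
    (mulClosure_le_mulClosure_projOperator _ Q le_rfl)

/-! ### A different decomposition when the regular part is unbounded -/

theorem starProjection_sup_span_singleton (M N : Submodule ℂ K) [M.HasOrthogonalProjection]
    [N.HasOrthogonalProjection] {e : K} (he : e ∈ Mᗮ) (hN : N = M ⊔ Submodule.span ℂ {e})
    (v : K) : N.starProjection v
      = M.starProjection v + (inner ℂ e v / ((‖e‖ ^ 2 : ℝ) : ℂ)) • e := by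
  have h : N.starProjection v = M.starProjection v + (Submodule.span ℂ {e}).starProjection v := by
    refine Submodule.eq_starProjection_of_mem_orthogonal (K := N) ?_ ?_
    · rw [hN]
      exact Submodule.add_mem_sup (M.starProjection_apply_mem v)
        (Submodule.starProjection_apply_mem _ v)
    · rw [hN, ← Submodule.inf_orthogonal]
      have hw : (Submodule.span ℂ {e}).starProjection v ∈ Mᗮ :=
        (Submodule.span_singleton_le_iff_mem e _).2 he
          ((Submodule.span ℂ {e}).starProjection_apply_mem v)
      have hm : M.starProjection v ∈ (Submodule.span ℂ {e})ᗮ := by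
        rw [Submodule.mem_orthogonal_singleton_iff_inner_right]
        exact Submodule.inner_left_of_mem_orthogonal (M.starProjection_apply_mem v) he
      constructor
      · rw [← sub_sub]
        exact sub_mem (M.sub_starProjection_mem_orthogonal v) hw
      · rw [← sub_sub, sub_right_comm]
        exact sub_mem (Submodule.sub_starProjection_mem_orthogonal v) hm
  rw [h, Submodule.starProjection_singleton]
  rfl

/-- Banach–Steinhaus: a weakly bounded linear map into a Hilbert space is bounded. -/
theorem exists_norm_le_of_inner_le [CompleteSpace K] {V : Type*} [NormedAddCommGroup V]
    [Module ℂ V] (A : V →ₗ[ℂ] K)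
    (h : ∀ e : K, ∃ C : ℝ, ∀ x : V, ‖inner ℂ e (A x)‖ ≤ C * ‖x‖) :
    ∃ C : ℝ, ∀ x : V, ‖A x‖ ≤ C * ‖x‖ := by
  obtain ⟨C, hC⟩ := banach_steinhaus
    (g := fun x : V => ((‖x‖⁻¹ : ℝ) : ℂ) • innerSL ℂ (A x)) fun e => by
      obtain ⟨C, hC⟩ := h e
      refine ⟨|C|, fun x => ?_⟩
      rw [smul_apply, innerSL_apply_apply, norm_smul, norm_inner_symm,
        Complex.norm_real, norm_inv, norm_norm]
      rcases eq_or_ne x 0 with rfl | hx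
      · simp
      · rw [inv_mul_le_iff₀ (norm_pos_iff.2 hx), mul_comm]
        exact (hC x).trans (mul_le_mul_of_nonneg_right (le_abs_self C) (norm_nonneg x))
  refine ⟨C, fun x => ?_⟩
  rcases eq_or_ne x 0 with rfl | hx
  · simp
  · have := hC x
    rwa [norm_smul, innerSL_apply_norm, Complex.norm_real, norm_inv, norm_norm,
      inv_mul_le_iff₀ (norm_pos_iff.2 hx), mul_comm] at this

theorem isBounded_regPart_iff [CompleteSpace K] (c : ℝ) (Q : H →ₗ.[ℂ] K) :
    (regPart c Q).IsBounded ↔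
      ∃ C : ℝ, ∀ φ : Q.domain, ‖regOperator Q φ‖ ≤ C * ‖(φ : H)‖ := by
  constructor
  · rintro ⟨a, -, ha⟩
    refine ⟨√(a + |c|), fun φ => ?_⟩
    have h := ha φ
    rw [show regPart c Q φ φ = _ from addConst_ofOperator_self (regOperator Q) c φ,
      Complex.norm_real, Real.norm_eq_abs] at h
    have h₁ := (le_abs_self _).trans h
    have h₂ : ‖regOperator Q φ‖ ^ 2 ≤ (a + |c|) * ‖(φ : H)‖ ^ 2 := by
      have := mul_le_mul_of_nonneg_right (neg_abs_le c) (sq_nonneg ‖(φ : H)‖)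
      linarith
    have h₃ := Real.sqrt_le_sqrt h₂
    rwa [Real.sqrt_sq (norm_nonneg _), Real.sqrt_mul' _ (sq_nonneg _),
      Real.sqrt_sq (norm_nonneg _)] at h₃
  · rintro ⟨C, hC⟩
    refine ⟨C ^ 2 + |c|, by positivity, fun φ => ?_⟩
    rw [show regPart c Q φ φ = _ from addConst_ofOperator_self (regOperator Q) c φ,
      Complex.norm_real, Real.norm_eq_abs]
    refine (abs_add_le _ _).trans ?_
    rw [abs_mul, abs_sq, abs_sq, add_mul, ← mul_pow]
    gcongr
    exact hC φ

/-- If the regular part is unbounded, some functional `(Q ·, e)` with `e ⊥ mul Q**` takes the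
value `1` along a null sequence. -/
theorem exists_seq_of_not_isBounded [CompleteSpace K] {c : ℝ} {Q : H →ₗ.[ℂ] K}
    (hQ : ¬ (regPart c Q).IsBounded) :
    ∃ e ∈ (mulClosure Q)ᗮ, ∃ g : ℕ → Q.domain,
      Tendsto (fun n => (g n : H)) atTop (𝓝 0) ∧ ∀ n, inner ℂ e (Q (g n)) = 1 := by
  rw [isBounded_regPart_iff] at hQ
  have h : ¬ ∀ e : K, ∃ C : ℝ, ∀ φ : Q.domain,
      ‖inner ℂ e ((regOperator Q).toFun φ)‖ ≤ C * ‖φ‖ :=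
    fun h => hQ (exists_norm_le_of_inner_le (regOperator Q).toFun h)
  push Not at h
  obtain ⟨e, he⟩ := h
  choose x hx using fun n : ℕ => he (n + 1)
  set P := (mulClosure Q).starProjection with hP
  have hval (φ : Q.domain) :
      inner ℂ (e - P e) (Q φ) = inner ℂ e ((regOperator Q).toFun φ) := by
    change _ = inner ℂ e (Q φ - P (Q φ))
    rw [inner_sub_left, inner_sub_right, hP, Submodule.inner_starProjection_left_eq_right]
  refine ⟨e - P e, Submodule.sub_starProjection_mem_orthogonal e,
    fun n => (inner ℂ (e - P e) (Q (x n)))⁻¹ • x n, ?_, fun n => ?_⟩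
  · refine squeeze_zero_norm (fun n => ?_) tendsto_one_div_add_atTop_nhds_zero_nat
    have hpos : 0 < ‖inner ℂ (e - P e) (Q (x n))‖ := by
      rw [hval]
      exact (by positivity : (0 : ℝ) ≤ (n + 1) * ‖x n‖).trans_lt (hx n)
    rw [Submodule.coe_smul, norm_smul, norm_inv, inv_mul_le_iff₀ hpos, mul_one_div,
      le_div_iff₀' (by positivity), hval]
    exact (hx n).le
  · rw [Q.map_smul, inner_smul_right]
    refine inv_mul_cancel₀ (norm_pos_iff.1 ?_)
    rw [hval]
    exact (by positivity : (0 : ℝ) ≤ (n + 1) * ‖x n‖).trans_lt (hx n)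

/-- When the regular part is unbounded, transferring the one-dimensional piece of `Q` along `e`
from the regular to the singular part gives a Lebesgue type decomposition with another singular
part. -/
theorem exists_isLebesgueTypeDecomposition_ne [CompleteSpace K] {c : ℝ} {Q : H →ₗ.[ℂ] K}
    (hQ : ¬ (regPart c Q).IsBounded) :
    ∃ t₁ t₂ : SesqForm H, ((ofOperator Q).addConst c).IsLebesgueTypeDecomposition t₁ t₂ ∧
      t₂ ≠ singPart Q := by
  obtain ⟨e, he, g, hg, hge⟩ := exists_seq_of_not_isBounded hQ
  have he0 : e ≠ 0 := by
    rintro rfl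
    simpa using hge 0
  have hr0 : (((‖e‖ ^ 2 : ℝ) : ℂ))⁻¹ ≠ 0 := by
    simpa using he0
  obtain ⟨N, hN⟩ : ∃ N, N = mulClosure Q ⊔ Submodule.span ℂ {e} := ⟨_, rfl⟩
  have hcl : IsClosed (N : Set K) := by
    rw [hN]
    exact Submodule.isClosed_sup_finiteDimensional _ _ (isClosed_mulClosure Q)
  have : CompleteSpace N := hcl.completeSpace_coe
  have hMN : mulClosure Q ≤ N := hN ▸ le_sup_left
  have hM := mulClosure_le_mulClosure_projOperator N Q hMN
  have hP (n : ℕ) : N.starProjection (Q (g n))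
      = (mulClosure Q).starProjection (Q (g n)) + (((‖e‖ ^ 2 : ℝ) : ℂ))⁻¹ • e := by
    rw [starProjection_sup_span_singleton _ N he hN, hge, one_div]
  -- Subtracting `(0, P₀ Q (g n))` from `(g n, P Q (g n))` leaves a fixed multiple of `e` in the
  -- second entry, although `P₀ Q (g n)` itself need not converge.
  have heN : e ∈ mulClosure (projOperator N Q) := by
    have hmem (n : ℕ) : ((g n : H), (((‖e‖ ^ 2 : ℝ) : ℂ))⁻¹ • e)
        ∈ (projOperator N Q).graph.topologicalClosure := by
      have h₁ := (projOperator N Q).graph.le_topologicalClosure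
        ((projOperator N Q).mem_graph (g n))
      have h₂ := sub_mem h₁ (hM (Submodule.starProjection_apply_mem _ (Q (g n))))
      rw [projOperator_apply, hP] at h₂
      simpa using h₂
    have hlim := (projOperator N Q).graph.isClosed_topologicalClosure.mem_of_tendsto
      (hg.prodMk_nhds tendsto_const_nhds) (.of_forall hmem)
    exact (Submodule.smul_mem_iff (mulClosure (projOperator N Q)) hr0).1 hlim
  refine ⟨_, _, isLebesgueTypeDecomposition_of_projection N Q c
    (mulClosure_coprojOperator_le N Q e hN)
    (hN.le.trans (sup_le hM ((Submodule.span_singleton_le_iff_mem _ _).2 heN))), fun heq => ?_⟩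
  have h := apply_eq_of_eq heq (g 0) (g 0) (g 0).2 (g 0).2 (g 0).2 (g 0).2
  have h' := (ofOperator_self (projOperator N Q) (g 0)).symm.trans
    (h.trans (ofOperator_self (singOperator Q) (g 0)))
  change ((‖N.starProjection (Q (g 0))‖ ^ 2 : ℝ) : ℂ)
    = ((‖(mulClosure Q).starProjection (Q (g 0))‖ ^ 2 : ℝ) : ℂ) at h'
  rw [Complex.ofReal_inj, hP, pow_two, norm_add_sq_eq_norm_sq_add_norm_sq_of_inner_eq_zero
    (𝕜 := ℂ) _ _ (Submodule.inner_right_of_mem_orthogonal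
      (Submodule.starProjection_apply_mem _ (Q (g 0))) (Submodule.smul_mem _ _ he)),
    ← pow_two, add_eq_left, mul_self_eq_zero, norm_eq_zero, smul_eq_zero] at h'
  exact h'.elim hr0 he0

/-! ### Maximality of the regular part, and uniqueness -/

/-- A closable form below a form represented by `A` stays below it after subtraction from `A φ` of
any `m ∈ mul A**`: perturb `φ` by a null sequence `h n` with `A (h n) → m`; by closability the
smaller form does not see the perturbation. -/
theorem norm_sq_le_of_isClosable {L : Type*} [NormedAddCommGroup L] [InnerProductSpace ℂ L]
    {D : Submodule ℂ H} (A : D →ₗ[ℂ] K) (B : D →ₗ[ℂ] L) (b d : ℝ)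
    (hle : ∀ φ : D, ‖B φ‖ ^ 2 ≤ ‖A φ‖ ^ 2 + d * ‖(φ : H)‖ ^ 2)
    (hB : ((ofOperator ⟨D, B⟩).addConst b).IsClosable) (φ : D) {m : K}
    (hm : m ∈ mulClosure ⟨D, A⟩) :
    ‖B φ‖ ^ 2 ≤ ‖A φ - m‖ ^ 2 + d * ‖(φ : H)‖ ^ 2 := by
  obtain ⟨h, h₀, h₁⟩ := (mem_mulClosure_iff _ _).1 hm
  change ℕ → D at h
  change Tendsto (fun n => A (h n)) atTop (𝓝 m) at h₁
  have hval (x : D) : (ofOperator ⟨D, B⟩).addConst b x x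
      = ((‖B x‖ ^ 2 + b * ‖(x : H)‖ ^ 2 : ℝ) : ℂ) := addConst_ofOperator_self ⟨D, B⟩ b x
  have hd₀ : Tendsto (fun p : ℕ × ℕ => ‖((h p.1 - h p.2 : D) : H)‖ ^ 2) atTop (𝓝 0) := by
    have := (((h₀.comp tendsto_fst).sub (h₀.comp tendsto_snd)).norm.pow 2)
    rw [prod_atTop_atTop_eq] at this
    simpa using this
  have hd₁ : Tendsto (fun p : ℕ × ℕ => ‖A (h p.1 - h p.2)‖ ^ 2) atTop (𝓝 0) := by
    have := (((h₁.comp tendsto_fst).sub (h₁.comp tendsto_snd)).norm.pow 2)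
    rw [prod_atTop_atTop_eq] at this
    simpa using this
  have hd₂ : Tendsto (fun p : ℕ × ℕ => ‖B (h p.1 - h p.2)‖ ^ 2) atTop (𝓝 0) :=
    squeeze_zero (fun _ => sq_nonneg _) (fun p => hle _)
      (by simpa using hd₁.add (hd₀.const_mul d))
  have hcl := hB h h₀ (by
    have := (Complex.continuous_ofReal.tendsto _).comp (hd₂.add (hd₀.const_mul b))
    simp only [mul_zero, add_zero, Complex.ofReal_zero] at this
    exact this.congr fun p => (hval (h p.1 - h p.2)).symm)
  have hBh : Tendsto (fun n => ‖B (h n)‖ ^ 2) atTop (𝓝 0) := by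
    have h₃ := ((Complex.continuous_re.tendsto 0).comp hcl).sub
      ((h₀.norm.pow 2).const_mul b)
    simp only [norm_zero, Complex.zero_re, ne_eq, OfNat.ofNat_ne_zero, not_false_eq_true,
      zero_pow, mul_zero, sub_zero] at h₃
    refine h₃.congr fun n => ?_
    change ((ofOperator ⟨D, B⟩).addConst b (h n) (h n)).re - _ = _
    rw [hval, Complex.ofReal_re, add_sub_cancel_right]
  have hBh' : Tendsto (fun n => B (h n)) atTop (𝓝 0) := by
    rw [tendsto_zero_iff_norm_tendsto_zero]
    simpa [Real.sqrt_sq (norm_nonneg _)] using hBh.sqrt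
  have hl := (hBh'.const_sub (B φ)).norm.pow 2
  have hr := ((h₁.const_sub (A φ)).norm.pow 2).add
    (((h₀.const_sub (φ : H)).norm.pow 2).const_mul d)
  rw [sub_zero] at hl hr
  refine le_of_tendsto_of_tendsto' hl hr fun n => ?_
  simpa using hle (φ - h n)

theorem tendsto_norm_sq_of_norm_sq_le {L : Type*} [NormedAddCommGroup L] [InnerProductSpace ℂ L]
    {D : Submodule ℂ H} (B : D →ₗ[ℂ] L) {C : ℝ}
    (hC : ∀ φ : D, ‖B φ‖ ^ 2 ≤ C * ‖(φ : H)‖ ^ 2) {x : ℕ → D} {φ : D}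
    (hx : Tendsto (fun n => (x n : H)) atTop (𝓝 (φ : H))) :
    Tendsto (fun n => ‖B (x n)‖ ^ 2) atTop (𝓝 (‖B φ‖ ^ 2)) := by
  have h : Tendsto (fun n => ‖B (x n - φ)‖ ^ 2) atTop (𝓝 0) :=
    squeeze_zero (fun _ => sq_nonneg _) (fun n => hC _)
      (by simpa using ((hx.sub_const (φ : H)).norm.pow 2).const_mul C)
  have h' : Tendsto (fun n => B (x n) - B φ) atTop (𝓝 0) := by
    rw [tendsto_zero_iff_norm_tendsto_zero]
    simpa [Real.sqrt_sq (norm_nonneg _)] using h.sqrt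
  exact (tendsto_sub_nhds_zero_iff.1 h').norm.pow 2

/-- If the regular part is bounded, so is every closable part `t₁`, and the singular part `t₂` is
`t_sing` plus the bounded nonnegative form `t_reg - t₁`. The latter is continuous and below a
singular form, hence zero. -/
theorem eq_regPart_of_isBounded [CompleteSpace K] {c : ℝ} {Q : H →ₗ.[ℂ] K}
    (hb : (regPart c Q).IsBounded) {t₁ t₂ : SesqForm H}
    (h : ((ofOperator Q).addConst c).IsLebesgueTypeDecomposition t₁ t₂) : t₁ = regPart c Q := by
  obtain ⟨C, hC⟩ := (isBounded_regPart_iff c Q).1 hb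
  obtain ⟨b, hlow⟩ := h.semibounded_left
  obtain ⟨L, _, _, _, ⟨D₁, B⟩, hB⟩ := exists_isRepresentingMap t₁ b hlow
  obtain rfl := hB.eq_addConst
  obtain ⟨D, A⟩ := Q
  obtain rfl : D₁ = D := h.domain_left
  obtain ⟨D₂, f⟩ := t₂
  obtain rfl : D₂ = D₁ := h.domain_right
  let R : D₂ →ₗ[ℂ] K := (regOperator ⟨D₂, A⟩).toFun
  let S : D₂ →ₗ[ℂ] K := (singOperator ⟨D₂, A⟩).toFun
  replace hC (φ : D₂) : ‖R φ‖ ^ 2 ≤ C ^ 2 * ‖(φ : H)‖ ^ 2 := by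
    rw [← mul_pow]
    exact pow_le_pow_left₀ (norm_nonneg _) (hC φ) 2
  have hpyth (φ : D₂) : ‖A φ‖ ^ 2 = ‖R φ‖ ^ 2 + ‖S φ‖ ^ 2 :=
    norm_sq_eq_coproj_add_proj (mulClosure ⟨D₂, A⟩) (A φ)
  have hsum (φ : D₂) : ‖A φ‖ ^ 2 + c * ‖(φ : H)‖ ^ 2
      = ‖B φ‖ ^ 2 + b * ‖(φ : H)‖ ^ 2 + (f φ φ).re := by
    have h₁ := congrArg Complex.re
      (apply_eq_of_eq h.sum_eq φ φ φ.2 ⟨φ.2, φ.2⟩ φ.2 ⟨φ.2, φ.2⟩)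
    rw [add_apply, Complex.add_re] at h₁
    have h₂ := congrArg Complex.re (addConst_ofOperator_self ⟨D₂, A⟩ c φ)
    have h₃ := congrArg Complex.re (addConst_ofOperator_self ⟨D₂, B⟩ b φ)
    rw [Complex.ofReal_re] at h₂ h₃
    exact h₂.symm.trans (h₁.trans (congrArg (· + (f φ φ).re) h₃))
  have hnn (φ : D₂) : 0 ≤ (f φ φ).re := (h.nonneg_right φ).2
  have hmax (φ : D₂) : ‖B φ‖ ^ 2 ≤ ‖R φ‖ ^ 2 + (c - b) * ‖(φ : H)‖ ^ 2 :=
    norm_sq_le_of_isClosable A B b (c - b) (fun x => by linarith [hsum x, hnn x])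
      h.closable_left φ (Submodule.starProjection_apply_mem _ (A φ))
  have heq (φ : D₂) : ‖B φ‖ ^ 2 = ‖R φ‖ ^ 2 + (c - b) * ‖(φ : H)‖ ^ 2 := by
    refine (hmax φ).antisymm ?_
    obtain ⟨x, hx, hfx⟩ := h.singular_right φ
    change ℕ → D₂ at x
    have hf : Tendsto (fun n => (f (x n) (x n)).re) atTop (𝓝 0) :=
      (Complex.continuous_re.tendsto 0).comp hfx
    have hBx := tendsto_norm_sq_of_norm_sq_le B (C := C ^ 2 + (c - b))
      (fun y => by linarith [hmax y, hC y]) hx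
    have hRx := (tendsto_norm_sq_of_norm_sq_le R hC hx).add
      ((hx.norm.pow 2).const_mul (c - b))
    have hlim := hBx.add hf
    rw [add_zero] at hlim
    refine le_of_tendsto_of_tendsto' hRx hlim fun n => ?_
    linarith [hsum (x n), hpyth (x n), sq_nonneg ‖S (x n)‖]
  refine eq_of_apply_self_eq rfl fun φ hφ _ => ?_
  refine (addConst_ofOperator_self ⟨D₂, B⟩ b ⟨φ, hφ⟩).trans
    (Eq.trans ?_ (addConst_ofOperator_self (regOperator ⟨D₂, A⟩) c ⟨φ, hφ⟩).symm)
  have := heq ⟨φ, hφ⟩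
  refine congrArg _ ?_
  change ‖B ⟨φ, hφ⟩‖ ^ 2 + b * ‖φ‖ ^ 2 = ‖R ⟨φ, hφ⟩‖ ^ 2 + c * ‖φ‖ ^ 2
  rw [this]
  ring

end SesqForm

theorem mainTheorem5 {H : Type u} [NormedAddCommGroup H] [InnerProductSpace ℂ H] [CompleteSpace H]
    {K : Type v} [NormedAddCommGroup K] [InnerProductSpace ℂ K] [CompleteSpace K]
    (t : SesqForm H) (c : ℝ) (hc : t.IsBoundedBelow c)
    (Q : H →ₗ.[ℂ] K) (hQ : t.IsRepresentingMap c Q) :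
    (∀ t₁ t₂ : SesqForm H, t.IsLebesgueTypeDecomposition t₁ t₂ ↔
        t₁ = SesqForm.regPart c Q ∧ t₂ = SesqForm.singPart Q) ↔
      (SesqForm.regPart c Q).IsBounded := by
  obtain rfl := hQ.eq_addConst
  have hdec := SesqForm.isLebesgueTypeDecomposition_regPart_singPart c Q
  constructor
  · intro h
    by_contra hb
    obtain ⟨t₁, t₂, ht, hne⟩ := SesqForm.exists_isLebesgueTypeDecomposition_ne hb
    exact hne ((h t₁ t₂).1 ht).2
  · intro hb t₁ t₂
    refine ⟨fun ht => ?_, fun ht => ht.1 ▸ ht.2 ▸ hdec⟩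
    obtain rfl := SesqForm.eq_regPart_of_isBounded hb ht
    exact ⟨rfl, SesqForm.eq_right_of_add_eq_add (ht.domain_right.trans ht.domain_left.symm)
      (hdec.domain_right.trans hdec.domain_left.symm) (ht.sum_eq.symm.trans hdec.sum_eq)⟩
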